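/- Let $\mathcal S$ be a measurable state space, $\mathcal A$ a nonempty finite action set, and $\gamma\in(0,1)$. For each $(s,a)$ let $P(\cdot\mid s,a)$ be the joint law of the random reward and next state $(\tilde r(s,a),\tilde s')$, forming a Markov kernel from $\mathcal S\times\mathcal A$ to $\mathbb R\times\mathcal S$, and suppose that the rewards are uniformly bounded: for some $C$, $|\tilde r(s,a)|\le C$ almost surely for all $(s,a)$. (This includes finite $\mathcal S$, $\mathcal A$ with finitely supported random rewards.) For a bounded random variable $\tilde x$ and $\alpha\in[0,1)$ put $\mathrm{VaR}_\alpha[\tilde x]:=\max\{x\in\mathbb R:\ \mathbb P[\tilde x<x]\le\alpha\}$. Let $\mathcal Q$ be the set of bounded measurable functions $q:\mathcal S\times[0,1)\times\mathcal A\to\mathbb R$ with sup norm $\|q\|_\infty$, and define $$\mathcal B q(s,\alpha,a):=\mathrm{VaR}_\alpha\big[\tilde r(s,a)+\gamma\max_{a'\in\mathcal A}q(\tilde s',\tilde u,a')\big],$$ where $\tilde u\sim U[0,1]$ is independent of $(\tilde r(s,a),\tilde s')$. A history-dependent policy $\pi$ chooses $a_k$ for $k\ge1$ from the history $(s_0,a_0,r_0,s_1,\dots,a_{k-1},r_{k-1},s_k)$,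 possibly at random (through a Markov kernel); it is deterministic if each $a_k$ is a measurable function of the history. Define, over all history-dependent policies, $$q_T^*(s,\alpha,a):=\sup_\pi \mathrm{VaR}^\pi_\alpha\Big[\sum_{t=0}^{T-1}\gamma^t\tilde r_t\,\Big|\,\tilde s_0=s,\tilde a_0=a\Big],\qquad q^*(s,\alpha,a):=\sup_\pi \mathrm{VaR}^\pi_\alpha\Big[\sum_{t=0}^{\infty}\gamma^t\tilde r_t\,\Big|\,\tilde s_0=s,\tilde a_0=a\Big].$$ Then: 1. $\mathcal B$ maps $\mathcal Q$ into $\mathcal Q$ and $\|\mathcal Bq^1-\mathcal Bq^2\|_\infty\le\gamma\|q^1-q^2\|_\infty$ for all $q^1,q^2\in\mathcal Q$. 2. For every $(s,\alpha,a)$ and $T\ge 0$ the suprema defining $q_T^*(s,\alpha,a)$ and $q^*(s,\alpha,a)$ are maxima, and each is attained by a deterministic history-dependent policy. 3. $q^*\in\mathcal Q$, and $q^*$ is the unique solution in $\mathcal Q$ of the nested VaR Bellman optimality equation $q=\mathcal Bq$. 4. $q_T^*=\mathcal B^T 0$ for all $T\ge 0$, $\|q_T^*-q^*\|_\infty\le\gamma^T\|q^*\|_\infty$,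 and hence $q_T^*\to q^*$ uniformly as $T\to\infty$. -/

import Mathlib

open MeasureTheory ProbabilityTheory

noncomputable section

namespace QuantileMDP

/-- `VaR_α[X] = max {x ∈ ℝ | P[X < x] ≤ α}`, the upper `α`-quantile of `X` under `μ`. The lemma
`VaR_isGreatest` below shows that for bounded `X` and `α ∈ [0,1)` the supremum is a maximum. -/
def VaR {Ω : Type*} [MeasurableSpace Ω] (μ : Measure Ω) (X : Ω → ℝ) (α : ℝ) : ℝ :=
  sSup {x : ℝ | μ.real {ω | X ω < x} ≤ α}

theorem VaR_isGreatest {Ω : Type*} [MeasurableSpace Ω] (μ : Measure Ω) [IsProbabilityMeasure μ]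
    (X : Ω → ℝ) (C : ℝ) (hX : ∀ᵐ ω ∂μ, |X ω| ≤ C) (α : ℝ) (h0 : 0 ≤ α) (h1 : α < 1) :
    IsGreatest {x : ℝ | μ.real {ω | X ω < x} ≤ α} (VaR μ X α) := by
  have hne : -C ∈ {x : ℝ | μ.real {ω | X ω < x} ≤ α} := by
    have : μ {ω | X ω < -C} = 0 := by
      refine measure_mono_null ?_ (ae_iff.1 hX)
      intro ω (hω : X ω < -C) h
      linarith [(abs_le.1 h).1]
    simp [Measure.real, this, h0]
  have hbdd : BddAbove {x : ℝ | μ.real {ω | X ω < x} ≤ α} := by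
    refine ⟨C, fun x hx => ?_⟩
    by_contra! hlt
    have : μ {ω | X ω < x} = μ Set.univ := by
      refine measure_congr ?_
      filter_upwards [hX] with ω hω
      have : X ω < x := by linarith [(abs_le.1 hω).2]
      exact propext ⟨fun _ => trivial, fun _ => this⟩
    have h2 : μ.real {ω | X ω < x} ≤ α := hx
    simp [Measure.real, this] at h2
    linarith
  refine ⟨?_, fun x hx => le_csSup hbdd hx⟩
  have hU : {ω | X ω < VaR μ X α} = ⋃ n : ℕ, {ω | X ω < VaR μ X α - 1 / ((n : ℝ) + 1)} := by
    ext ω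
    simp only [Set.mem_ofPred_eq, Set.mem_iUnion]
    constructor
    · intro h
      obtain ⟨n, hn⟩ := exists_nat_one_div_lt (sub_pos.2 h)
      exact ⟨n, by linarith⟩
    · rintro ⟨n, hn⟩
      have : 0 < 1 / ((n : ℝ) + 1) := by positivity
      linarith
  have hmono : Monotone fun n : ℕ => {ω | X ω < VaR μ X α - 1 / ((n : ℝ) + 1)} := by
    intro m n hmn ω (hω : X ω < VaR μ X α - 1 / ((m : ℝ) + 1))
    have : 1 / ((n : ℝ) + 1) ≤ 1 / ((m : ℝ) + 1) := Nat.one_div_le_one_div hmn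
    show X ω < VaR μ X α - 1 / ((n : ℝ) + 1)
    linarith
  have key : μ {ω | X ω < VaR μ X α} ≤ ENNReal.ofReal α := by
    rw [hU, hmono.measure_iUnion]
    refine iSup_le fun n => ?_
    have hpos : 0 < 1 / ((n : ℝ) + 1) := by positivity
    obtain ⟨y, hy, hlt⟩ := exists_lt_of_lt_csSup ⟨_, hne⟩
      (show VaR μ X α - 1 / ((n : ℝ) + 1) < sSup {x : ℝ | μ.real {ω | X ω < x} ≤ α} from
        sub_lt_self _ hpos)
    calc μ {ω | X ω < VaR μ X α - 1 / ((n : ℝ) + 1)} ≤ μ {ω | X ω < y} :=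
          measure_mono fun ω (hω : X ω < _) => hω.trans hlt
      _ = ENNReal.ofReal (μ.real {ω | X ω < y}) := (ofReal_measureReal).symm
      _ ≤ ENNReal.ofReal α := ENNReal.ofReal_le_ofReal hy
  exact ENNReal.toReal_le_of_le_ofReal h0 key

/-- Quantile levels `α ∈ [0,1)`. -/
abbrev Level : Type := Set.Ico (0 : ℝ) 1

/-- The law `U[0,1]`, as a measure on `[0,1)` (the endpoint `1` has no mass). -/
def unif : Measure Level := (volume : Measure ℝ).comap Subtype.val

instance : IsProbabilityMeasure unif := by
  constructor
  rw [unif, comap_subtype_coe_apply measurableSet_Ico, Set.image_univ, Subtype.range_coe,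
    Real.volume_Ico, sub_zero, ENNReal.ofReal_one]

/-- `max_{a'} q(s,α,a')`. -/
def maxAct {S A : Type*} [Fintype A] [Nonempty A] (q : S × Level × A → ℝ) (s : S) (α : Level) : ℝ :=
  Finset.univ.sup' Finset.univ_nonempty fun a' : A => q (s, α, a')

/-- Candidate value functions: bounded and measurable. -/
structure IsQFunction {S A : Type*} [MeasurableSpace S] [MeasurableSpace A]
    (q : S × Level × A → ℝ) : Prop where
  measurable : Measurable q
  bounded : ∃ M : ℝ, ∀ p, |q p| ≤ M

/-- Sup norm of a bounded function. -/
def supNorm {S A : Type*} (q : S × Level × A → ℝ) : ℝ := ⨆ p, |q p|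

/-- The nested VaR Bellman optimality operator
`(𝓑 q)(s,α,a) = VaR_α[r̃ + γ max_{a'} q(s̃',ũ,a')]`, where `(r̃, s̃')` has law `P (s,a)` and
`ũ ~ U[0,1]` is independent of it. -/
def bellman {S A : Type*} [MeasurableSpace S] [MeasurableSpace A] [Fintype A] [Nonempty A]
    (P : Kernel (S × A) (ℝ × S)) (γ : ℝ) (q : S × Level × A → ℝ) : S × Level × A → ℝ :=
  fun p => VaR ((P (p.1, p.2.2)).prod unif)
    (fun z : (ℝ × S) × Level => z.1.1 + γ * maxAct q z.1.2 z.2) (p.2.1 : ℝ)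

/-- One step of a trajectory, `((r_{k-1}, s_k), a_k)`: the reward received on arrival, the state
and the action. At time `0` the reward entry is a dummy `0`. -/
abbrev Step (S A : Type*) : Type _ := (ℝ × S) × A

/-- A (randomized) history-dependent policy. The first action `a_0` is prescribed by the
conditioning in `q*`, so the decision rules start at time `1`: `rule n` chooses `a_{n+1}` from the
history `(s_0,a_0,r_0,s_1,a_1,r_1,…,s_n,a_n,r_n,s_{n+1})`, given as the first `n+1` steps and
`(r_n, s_{n+1})`. -/
structure Policy (S A : Type*) [MeasurableSpace S] [MeasurableSpace A] where
  rule : (n : ℕ) → Kernel (((i : Finset.Iic n) → Step S A) × (ℝ × S)) A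
  isMarkov : ∀ n, IsMarkovKernel (rule n)

/-- The policy chooses its actions as (measurable) functions of the history. -/
def Policy.IsDeterministic {S A : Type*} [MeasurableSpace S] [MeasurableSpace A]
    (π : Policy S A) : Prop :=
  ∀ n, ∃ (f : ((i : Finset.Iic n) → Step S A) × (ℝ × S) → A) (hf : Measurable f),
    π.rule n = Kernel.deterministic f hf

/-- The current state-action pair of a history of `n+1` steps. -/
def lastPair {S A : Type*} (n : ℕ) (h : (i : Finset.Iic n) → Step S A) : S × A :=
  ((h ⟨n, Finset.mem_Iic.2 le_rfl⟩).1.2, (h ⟨n, Finset.mem_Iic.2 le_rfl⟩).2)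

theorem measurable_lastPair {S A : Type*} [MeasurableSpace S] [MeasurableSpace A] (n : ℕ) :
    Measurable (lastPair n : ((i : Finset.Iic n) → Step S A) → S × A) := by
  unfold lastPair
  fun_prop

/-- Transition law of the trajectory under `π`: `(r_n, s_{n+1}) ~ P (s_n, a_n)`, then `a_{n+1}` is
drawn from the decision rule of `π`. -/
def stepKernel {S A : Type*} [MeasurableSpace S] [MeasurableSpace A]
    (P : Kernel (S × A) (ℝ × S)) (π : Policy S A) (n : ℕ) :
    Kernel ((i : Finset.Iic n) → Step S A) (Step S A) :=
  (P.comap (lastPair n) (measurable_lastPair n)).compProd (π.rule n)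

instance {S A : Type*} [MeasurableSpace S] [MeasurableSpace A]
    (P : Kernel (S × A) (ℝ × S)) [IsMarkovKernel P] (π : Policy S A) (n : ℕ) :
    IsMarkovKernel (stepKernel P π n) := by
  have := π.isMarkov n
  unfold stepKernel
  infer_instance

/-- Law of the infinite trajectory under `π` given `s_0 = s`, `a_0 = a` (Ionescu-Tulcea). -/
def trajLaw {S A : Type*} [MeasurableSpace S] [MeasurableSpace A]
    (P : Kernel (S × A) (ℝ × S)) [IsMarkovKernel P] (π : Policy S A) (s : S) (a : A) :
    Measure (ℕ → Step S A) :=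
  Kernel.traj (X := fun _ => Step S A) (stepKernel P π) 0 fun _ => ((0, s), a)

/-- Reward `r_t` of a trajectory. -/
def reward {S A : Type*} (t : ℕ) (ω : ℕ → Step S A) : ℝ := (ω (t + 1)).1.1

/-- `VaR_α^π[∑_{t=0}^{T-1} γ^t r_t | s_0 = s, a_0 = a]`, with `p = (s,α,a)`. -/
def policyValueFin {S A : Type*} [MeasurableSpace S] [MeasurableSpace A]
    (P : Kernel (S × A) (ℝ × S)) [IsMarkovKernel P] (γ : ℝ) (T : ℕ) (p : S × Level × A)
    (π : Policy S A) : ℝ :=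
  VaR (trajLaw P π p.1 p.2.2) (fun ω => ∑ t ∈ Finset.range T, γ ^ t * reward t ω) (p.2.1 : ℝ)

/-- `VaR_α^π[∑_{t=0}^{∞} γ^t r_t | s_0 = s, a_0 = a]`, with `p = (s,α,a)`. -/
def policyValue {S A : Type*} [MeasurableSpace S] [MeasurableSpace A]
    (P : Kernel (S × A) (ℝ × S)) [IsMarkovKernel P] (γ : ℝ) (p : S × Level × A)
    (π : Policy S A) : ℝ :=
  VaR (trajLaw P π p.1 p.2.2) (fun ω => ∑' t, γ ^ t * reward t ω) (p.2.1 : ℝ)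

/-- Optimal finite-horizon value `q*_T(s,α,a)` over history-dependent policies. -/
def qFin {S A : Type*} [MeasurableSpace S] [MeasurableSpace A]
    (P : Kernel (S × A) (ℝ × S)) [IsMarkovKernel P] (γ : ℝ) (T : ℕ) : S × Level × A → ℝ :=
  fun p => sSup (Set.range (policyValueFin P γ T p))

/-- Optimal infinite-horizon value `q*(s,α,a)` over history-dependent policies. -/
def qStar {S A : Type*} [MeasurableSpace S] [MeasurableSpace A]
    (P : Kernel (S × A) (ℝ × S)) [IsMarkovKernel P] (γ : ℝ) : S × Level × A → ℝ :=
  fun p => sSup (Set.range (policyValue P γ p))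

end QuantileMDP

end

open QuantileMDP

/-! A quantile is at least `x` exactly when the probability of falling below `x` is at most `α`
(`le_VaR_iff`). Maximizing VaR is therefore minimizing a shortfall probability, an expectation to
which ordinary dynamic programming applies once the state carries the target still to be reached.

For `q` a quantile function in its level, `risk q s a x` is the distribution function that it
encodes. A Bellman step becomes linear: `risk (𝓑 q) s a x = E[min_{a'} risk q s' a' ((x - r)/γ)]`
(`risk_bellman_eq_lintegral`). The single level `ũ` shared by all actions causes no loss because the
shortfall events of different actions are nested. Along any policy the mean risk of the left-over
target can then only grow (`risk_le_meanRisk`), and it stays constant under the policy that is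
greedy for that target (`exists_meanRisk_eq_risk`).

With finite horizon the terminal risk is the indicator of missing the target, so the mean risk ends
at the shortfall probability of the return. With infinite horizon the left-over target is about `(x
- R)/γ ^ n`, where `R` is the return: it diverges to `±∞` unless `R = x`, and the risk tends to `1`
or `0`. Fatou's lemma and its reverse finish the two inequalities. The fixed point, its uniqueness
and the rate `γ ^ T` come from the contraction property. -/

noncomputable section

namespace QuantileMDP

/-! ### Quantiles -/

section VaR

variable {Ω : Type*} [MeasurableSpace Ω] {μ : Measure Ω} [IsProbabilityMeasure μ]
  {X Y : Ω → ℝ} {C α x : ℝ}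

/-- The supremum is attained and the admissible `x` form a lower set, so VaR and the shortfall
probability are adjoint. -/
theorem le_VaR_iff (hX : ∀ᵐ ω ∂μ, |X ω| ≤ C) (h0 : 0 ≤ α) (h1 : α < 1) :
    x ≤ VaR μ X α ↔ μ {ω | X ω < x} ≤ ENNReal.ofReal α := by
  have hg := VaR_isGreatest μ X C hX α h0 h1
  rw [← ENNReal.toReal_le_toReal (measure_ne_top _ _) ENNReal.ofReal_ne_top,
    ENNReal.toReal_ofReal h0]
  constructor
  · intro hx
    refine le_trans ?_ hg.1
    exact measureReal_mono fun ω (hω : X ω < x) => lt_of_lt_of_le hω hx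
  · intro hx
    exact hg.2 hx

theorem abs_VaR_le (hX : ∀ᵐ ω ∂μ, |X ω| ≤ C) (h0 : 0 ≤ α) (h1 : α < 1) : |VaR μ X α| ≤ C := by
  rw [abs_le]
  constructor
  · rw [le_VaR_iff hX h0 h1]
    have : μ {ω | X ω < -C} = 0 := by
      refine measure_mono_null ?_ (ae_iff.1 hX)
      intro ω (hω : X ω < -C) h
      linarith [(abs_le.1 h).1]
    simp [this]
  · by_contra! hlt
    have h := (le_VaR_iff hX h0 h1).1 (le_refl (VaR μ X α))
    have h2 : μ {ω | X ω < VaR μ X α} = 1 := by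
      rw [← measure_univ (μ := μ)]
      refine measure_congr (Filter.eventuallyEq_univ.2 ?_)
      filter_upwards [hX] with ω hω
      show X ω < VaR μ X α
      linarith [(abs_le.1 hω).2]
    rw [h2, ENNReal.one_le_ofReal] at h
    linarith

/-- If `Y` is below `VaR μ X α - c`, then `X` is below its own quantile. This is monotonicity and
translation invariance in one, the source of the contraction. -/
theorem VaR_le_VaR_add {D c : ℝ} (hX : ∀ᵐ ω ∂μ, |X ω| ≤ C) (hY : ∀ᵐ ω ∂μ, |Y ω| ≤ D)
    (h0 : 0 ≤ α) (h1 : α < 1) (h : ∀ ω, X ω ≤ Y ω + c) : VaR μ X α ≤ VaR μ Y α + c := by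
  rw [← sub_le_iff_le_add, le_VaR_iff hY h0 h1]
  refine le_trans (measure_mono fun ω (hω : Y ω < _) => ?_)
    ((le_VaR_iff hX h0 h1).1 (le_refl (VaR μ X α)))
  show X ω < VaR μ X α
  linarith [h ω]

end VaR

/-! ### Uniform levels and choices among finitely many alternatives -/

theorem unif_lt {p : ℝ} (hp : p ≤ 1) : unif {u : Level | (u : ℝ) < p} = ENNReal.ofReal p := by
  have : Subtype.val '' {u : Level | (u : ℝ) < p} = Set.Ico 0 p := by
    ext y
    simp only [Set.mem_image, Subtype.exists, Set.mem_Ico]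
    constructor
    · rintro ⟨z, hz, hzp, rfl⟩
      exact ⟨hz.1, hzp⟩
    · rintro ⟨h0, h1⟩
      exact ⟨y, ⟨h0, h1.trans_le hp⟩, h1, rfl⟩
  rw [unif, comap_subtype_coe_apply measurableSet_Ico, this, Real.volume_Ico, sub_zero]

/-- The intersection of finitely many lower sets of a linear order is one of them. -/
theorem exists_iInter_eq_of_isLowerSet {ι β : Type*} [Finite ι] [Nonempty ι] [LinearOrder β]
    (U : ι → Set β) (hU : ∀ i, IsLowerSet (U i)) : ∃ i, ⋂ j, U j = U i := by
  obtain ⟨i, hi⟩ := Set.Finite.exists_minimalFor U Set.univ Set.finite_univ Set.univ_nonempty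
  refine ⟨i, Set.Subset.antisymm (Set.iInter_subset _ i) (Set.subset_iInter fun j => ?_)⟩
  rcases (hU i).total (hU j) with h | h
  · exact h
  · exact hi.2 (Set.mem_univ j) h

/-- A measurable selection of minimizers over a finite set of actions. -/
theorem exists_measurable_argmin {X A : Type*} [MeasurableSpace X] [MeasurableSpace A] [Finite A]
    [Nonempty A] (g : X → A → ENNReal) (hg : ∀ a, Measurable fun x => g x a) :
    ∃ f : X → A, Measurable f ∧ ∀ x, g x (f x) = ⨅ a, g x a := by
  classical
  -- Taking the first minimizer in an enumeration by `ℕ` reduces measurability to that of the sets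
  -- where a given action is minimizing.
  obtain ⟨e, he⟩ := exists_surjective_nat A
  have hex : ∀ x, ∃ n, g x (e n) = ⨅ a, g x a := fun x => by
    obtain ⟨a, ha⟩ := exists_eq_ciInf_of_finite (f := g x)
    obtain ⟨n, rfl⟩ := he a
    exact ⟨n, ha⟩
  refine ⟨fun x => e (Nat.find (hex x)), ?_, fun x => Nat.find_spec (hex x)⟩
  refine (measurable_from_nat (f := e)).comp (measurable_find hex fun k => ?_)
  exact measurableSet_eq_fun (hg _) (.iInf hg)

/-! ### The Bellman operator -/

section MaxAct

variable {S A : Type*} [Fintype A] [Nonempty A]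

theorem maxAct_lt_iff {q : S × Level × A → ℝ} {s : S} {α : Level} {x : ℝ} :
    maxAct q s α < x ↔ ∀ a, q (s, α, a) < x := by
  simp [maxAct]

theorem abs_maxAct_le {q : S × Level × A → ℝ} {M : ℝ} (hM : ∀ p, |q p| ≤ M) (s : S) (α : Level) :
    |maxAct q s α| ≤ M := by
  rw [abs_le]
  constructor
  · obtain ⟨a⟩ := ‹Nonempty A›
    exact (abs_le.1 (hM (s, α, a))).1.trans
      (Finset.le_sup' (fun a' : A => q (s, α, a')) (Finset.mem_univ a))
  · exact Finset.sup'_le _ _ fun a _ => (abs_le.1 (hM (s, α, a))).2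

theorem maxAct_le_add {q₁ q₂ : S × Level × A → ℝ} {c : ℝ} (h : ∀ p, q₁ p ≤ q₂ p + c)
    (s : S) (α : Level) : maxAct q₁ s α ≤ maxAct q₂ s α + c := by
  refine Finset.sup'_le _ _ fun a _ => (h (s, α, a)).trans ?_
  gcongr
  exact Finset.le_sup' (fun a' : A => q₂ (s, α, a')) (Finset.mem_univ a)

end MaxAct

theorem IsQFunction.zero {S A : Type*} [MeasurableSpace S] [MeasurableSpace A] :
    IsQFunction (0 : S × Level × A → ℝ) :=
  ⟨measurable_const, 0, fun p => by simp⟩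

section Bellman

variable {S A : Type*} [MeasurableSpace S] [MeasurableSpace A] [Fintype A] [Nonempty A]

theorem measurable_maxAct {q : S × Level × A → ℝ} (hq : Measurable q) :
    Measurable fun y : S × Level => maxAct q y.1 y.2 := by
  have : (fun y : S × Level => maxAct q y.1 y.2)
      = Finset.univ.sup' Finset.univ_nonempty fun (a : A) (y : S × Level) => q (y.1, y.2, a) := by
    ext y
    simp [maxAct]
  rw [this]
  exact Finset.measurable_sup' _ fun a _ => by fun_prop

/-- The random variable `r̃ + γ max_{a'} q(s̃',ũ,a')`. -/
def backup (γ : ℝ) (q : S × Level × A → ℝ) (z : (ℝ × S) × Level) : ℝ :=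
  z.1.1 + γ * maxAct q z.1.2 z.2

theorem measurable_backup (γ : ℝ) {q : S × Level × A → ℝ} (hq : Measurable q) :
    Measurable (backup γ q) := by
  have := measurable_maxAct hq
  have h2 : Measurable fun z : (ℝ × S) × Level => maxAct q z.1.2 z.2 :=
    this.comp (by fun_prop : Measurable fun z : (ℝ × S) × Level => (z.1.2, z.2))
  unfold backup
  fun_prop

variable {P : Kernel (S × A) (ℝ × S)} {C γ : ℝ}

theorem ae_abs_backup_le (hC : ∀ (s : S) (a : A), ∀ᵐ z ∂(P (s, a)), |z.1| ≤ C) (hγ : 0 < γ)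
    {q : S × Level × A → ℝ} {M : ℝ} (hM : ∀ p, |q p| ≤ M) (s : S) (a : A) :
    ∀ᵐ z ∂((P (s, a)).prod unif), |backup γ q z| ≤ C + γ * M := by
  have h : ∀ᵐ z ∂((P (s, a)).prod unif), |z.1.1| ≤ C :=
    Measure.quasiMeasurePreserving_fst.ae (hC s a)
  filter_upwards [h] with z hz
  refine (abs_add_le _ _).trans (add_le_add hz ?_)
  rw [abs_mul, abs_of_pos hγ]
  exact mul_le_mul_of_nonneg_left (abs_maxAct_le hM _ _) hγ.le

variable [IsMarkovKernel P]

theorem le_bellman_iff (hC : ∀ (s : S) (a : A), ∀ᵐ z ∂(P (s, a)), |z.1| ≤ C) (hγ : 0 < γ)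
    {q : S × Level × A → ℝ} (hq : IsQFunction q) (s : S) (α : Level) (a : A) (x : ℝ) :
    x ≤ bellman P γ q (s, α, a) ↔
      (P (s, a)).prod unif {z | backup γ q z < x} ≤ ENNReal.ofReal α := by
  obtain ⟨M, hM⟩ := hq.bounded
  exact le_VaR_iff (ae_abs_backup_le hC hγ hM s a) α.2.1 α.2.2

theorem IsQFunction.bellman (hC : ∀ (s : S) (a : A), ∀ᵐ z ∂(P (s, a)), |z.1| ≤ C) (hγ : 0 < γ)
    {q : S × Level × A → ℝ} (hq : IsQFunction q) : IsQFunction (bellman P γ q) := by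
  constructor
  -- The superlevel set consists of the `(s, α, a)` whose shortfall probability is at most `α`, and
  -- that probability is a kernel integral, measurable in `(s, a)`.
  · refine measurable_of_Ici fun x => ?_
    have hset : MeasurableSet {z : (ℝ × S) × Level | backup γ q z < x} :=
      measurableSet_lt (measurable_backup γ hq.measurable) measurable_const
    have : QuantileMDP.bellman P γ q ⁻¹' Set.Ici x = {p : S × Level × A |
        (∫⁻ z, unif (Prod.mk z ⁻¹' {z : (ℝ × S) × Level | backup γ q z < x}) ∂P (p.1, p.2.2))
          ≤ ENNReal.ofReal (p.2.1 : ℝ)} := by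
      ext ⟨s, α, a⟩
      rw [Set.mem_preimage, Set.mem_Ici, le_bellman_iff hC hγ hq, Measure.prod_apply hset]
      rfl
    rw [this]
    refine measurableSet_le ?_ (by fun_prop)
    have h1 : Measurable fun p : S × A =>
        ∫⁻ z, unif (Prod.mk z ⁻¹' {z : (ℝ × S) × Level | backup γ q z < x}) ∂P p :=
      (measurable_measure_prodMk_left hset).lintegral_kernel
    exact h1.comp (by fun_prop : Measurable fun p : S × Level × A => (p.1, p.2.2))
  · obtain ⟨M, hM⟩ := hq.bounded
    exact ⟨C + γ * M, fun p => abs_VaR_le (ae_abs_backup_le hC hγ hM p.1 p.2.2) p.2.1.2.1 p.2.1.2.2⟩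

/-- Blackwell's conditions: the operator is monotone and turns a constant shift `c` into `γ * c`.
Used in both directions, this gives the contraction. -/
theorem bellman_le_add (hC : ∀ (s : S) (a : A), ∀ᵐ z ∂(P (s, a)), |z.1| ≤ C) (hγ : 0 < γ)
    {q₁ q₂ : S × Level × A → ℝ} (h₁ : IsQFunction q₁) (h₂ : IsQFunction q₂) {c : ℝ}
    (h : ∀ p, q₁ p ≤ q₂ p + c) (p : S × Level × A) :
    bellman P γ q₁ p ≤ bellman P γ q₂ p + γ * c := by
  obtain ⟨M₁, hM₁⟩ := h₁.bounded
  obtain ⟨M₂, hM₂⟩ := h₂.bounded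
  refine VaR_le_VaR_add (ae_abs_backup_le hC hγ hM₁ p.1 p.2.2)
    (ae_abs_backup_le hC hγ hM₂ p.1 p.2.2) p.2.1.2.1 p.2.1.2.2 fun z => ?_
  have := mul_le_mul_of_nonneg_left (maxAct_le_add h z.1.2 z.2) hγ.le
  linarith

theorem abs_bellman_sub_le (hC : ∀ (s : S) (a : A), ∀ᵐ z ∂(P (s, a)), |z.1| ≤ C) (hγ : 0 < γ)
    {q₁ q₂ : S × Level × A → ℝ} (h₁ : IsQFunction q₁) (h₂ : IsQFunction q₂) {c : ℝ}
    (h : ∀ p, |q₁ p - q₂ p| ≤ c) (p : S × Level × A) :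
    |bellman P γ q₁ p - bellman P γ q₂ p| ≤ γ * c := by
  have h12 := bellman_le_add hC hγ h₁ h₂ (c := c) (fun p => by linarith [(abs_le.1 (h p)).2]) p
  have h21 := bellman_le_add hC hγ h₂ h₁ (c := c) (fun p => by linarith [(abs_le.1 (h p)).1]) p
  rw [abs_le]
  constructor <;> linarith

end Bellman

/-! ### Contraction in sup norm and the fixed point -/

section SupNorm

variable {S A : Type*}

theorem supNorm_nonneg (q : S × Level × A → ℝ) : 0 ≤ supNorm q :=
  Real.iSup_nonneg fun _ => abs_nonneg _

/-- `0 ≤ c` is needed when `S` is empty: the supremum is then `0`. -/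
theorem supNorm_le {q : S × Level × A → ℝ} {c : ℝ} (hc : 0 ≤ c) (h : ∀ p, |q p| ≤ c) :
    supNorm q ≤ c :=
  Real.iSup_le h hc

theorem abs_le_supNorm {q : S × Level × A → ℝ} {M : ℝ} (h : ∀ p, |q p| ≤ M) (p : S × Level × A) :
    |q p| ≤ supNorm q :=
  le_ciSup (f := fun p => |q p|) ⟨M, by rintro _ ⟨p, rfl⟩; exact h p⟩ p

variable [MeasurableSpace S] [MeasurableSpace A]

theorem IsQFunction.sub {q₁ q₂ : S × Level × A → ℝ} (h₁ : IsQFunction q₁) (h₂ : IsQFunction q₂) :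
    IsQFunction (q₁ - q₂) := by
  obtain ⟨M₁, hM₁⟩ := h₁.bounded
  obtain ⟨M₂, hM₂⟩ := h₂.bounded
  exact ⟨h₁.measurable.sub h₂.measurable, M₁ + M₂,
    fun p => (abs_sub _ _).trans (add_le_add (hM₁ p) (hM₂ p))⟩

theorem IsQFunction.abs_le_supNorm {q : S × Level × A → ℝ} (h : IsQFunction q)
    (p : S × Level × A) : |q p| ≤ supNorm q :=
  let ⟨_, hM⟩ := h.bounded
  QuantileMDP.abs_le_supNorm hM p

variable [Fintype A] [Nonempty A] {P : Kernel (S × A) (ℝ × S)} [IsMarkovKernel P] {C γ : ℝ}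

theorem supNorm_bellman_sub_le (hC : ∀ (s : S) (a : A), ∀ᵐ z ∂(P (s, a)), |z.1| ≤ C) (hγ : 0 < γ)
    {q₁ q₂ : S × Level × A → ℝ} (h₁ : IsQFunction q₁) (h₂ : IsQFunction q₂) :
    supNorm (bellman P γ q₁ - bellman P γ q₂) ≤ γ * supNorm (q₁ - q₂) :=
  supNorm_le (mul_nonneg hγ.le (supNorm_nonneg _))
    (abs_bellman_sub_le hC hγ h₁ h₂ (h₁.sub h₂).abs_le_supNorm)

theorem bellman_unique (hC : ∀ (s : S) (a : A), ∀ᵐ z ∂(P (s, a)), |z.1| ≤ C) (hγ : 0 < γ)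
    (hγ1 : γ < 1) {q₁ q₂ : S × Level × A → ℝ} (h₁ : IsQFunction q₁) (h₂ : IsQFunction q₂)
    (hf₁ : bellman P γ q₁ = q₁) (hf₂ : bellman P γ q₂ = q₂) : q₁ = q₂ := by
  have h := supNorm_bellman_sub_le hC hγ h₁ h₂
  rw [hf₁, hf₂] at h
  have h0 : supNorm (q₁ - q₂) ≤ 0 := by nlinarith [supNorm_nonneg (q₁ - q₂)]
  ext p
  have := ((h₁.sub h₂).abs_le_supNorm p).trans h0
  exact sub_eq_zero.1 (abs_nonpos_iff.1 this)

theorem IsQFunction.iterate (hC : ∀ (s : S) (a : A), ∀ᵐ z ∂(P (s, a)), |z.1| ≤ C) (hγ : 0 < γ)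
    {q : S × Level × A → ℝ} (hq : IsQFunction q) (T : ℕ) :
    IsQFunction ((QuantileMDP.bellman P γ)^[T] q) := by
  induction T with
  | zero => exact hq
  | succ T ih =>
    rw [Function.iterate_succ_apply']
    exact ih.bellman hC hγ

theorem supNorm_iterate_sub_le (hC : ∀ (s : S) (a : A), ∀ᵐ z ∂(P (s, a)), |z.1| ≤ C) (hγ : 0 < γ)
    {q₁ q₂ : S × Level × A → ℝ} (h₁ : IsQFunction q₁) (h₂ : IsQFunction q₂) (T : ℕ) :
    supNorm ((bellman P γ)^[T] q₁ - (bellman P γ)^[T] q₂) ≤ γ ^ T * supNorm (q₁ - q₂) := by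
  induction T with
  | zero => simp
  | succ T ih =>
    rw [Function.iterate_succ_apply', Function.iterate_succ_apply']
    refine (supNorm_bellman_sub_le hC hγ (h₁.iterate hC hγ T) (h₂.iterate hC hγ T)).trans ?_
    rw [pow_succ', mul_assoc]
    exact mul_le_mul_of_nonneg_left ih hγ.le

/-- Picard iteration from `0`. The iterates are pointwise Cauchy at a geometric rate independent of
the point, so the limit is both measurable and bounded. -/
theorem exists_bellman_fixedPoint (hC : ∀ (s : S) (a : A), ∀ᵐ z ∂(P (s, a)), |z.1| ≤ C)
    (hγ : 0 < γ) (hγ1 : γ < 1) :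
    ∃ q : S × Level × A → ℝ, IsQFunction q ∧ bellman P γ q = q := by
  set Q : ℕ → S × Level × A → ℝ := fun n => (bellman P γ)^[n] 0 with hQ
  have hQq : ∀ n, IsQFunction (Q n) := fun n => IsQFunction.zero.iterate hC hγ n
  have hsucc : ∀ n, Q (n + 1) = bellman P γ (Q n) := fun n => Function.iterate_succ_apply' _ _ _
  set D := supNorm ((0 : S × Level × A → ℝ) - bellman P γ 0)
  have hstep : ∀ p n, dist (Q n p) (Q (n + 1) p) ≤ D * γ ^ n := fun p n => by
    have h1 := supNorm_iterate_sub_le hC hγ IsQFunction.zero (IsQFunction.zero.bellman hC hγ) n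
    rw [← Function.iterate_succ_apply] at h1
    rw [mul_comm]
    exact (((hQq n).sub (hQq (n + 1))).abs_le_supNorm p).trans h1
  have hlim : ∀ p, ∃ l, Filter.Tendsto (fun n => Q n p) Filter.atTop (nhds l) := fun p =>
    cauchySeq_tendsto_of_complete (cauchySeq_of_le_geometric γ D hγ1 (hstep p))
  choose q hq using hlim
  have hdist : ∀ n p, |Q n p - q p| ≤ D * γ ^ n / (1 - γ) := fun n p =>
    dist_le_of_le_geometric_of_tendsto γ D hγ1 (hstep p) (hq p) n
  have hqq : IsQFunction q := by
    refine ⟨measurable_of_tendsto_metrizable (fun n => (hQq n).measurable)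
      (tendsto_pi_nhds.2 hq), D * γ ^ 0 / (1 - γ), fun p => ?_⟩
    simpa [hQ] using hdist 0 p
  refine ⟨q, hqq, ?_⟩
  ext p
  -- `Q (n + 1) p` converges to `q p`, and by the Lipschitz bound also to `bellman P γ q p`.
  refine tendsto_nhds_unique ?_ ((Filter.tendsto_add_atTop_iff_nat 1).2 (hq p))
  rw [tendsto_iff_dist_tendsto_zero]
  refine squeeze_zero (fun _ => dist_nonneg) (g := fun n => γ * (D * γ ^ n / (1 - γ))) (fun n => ?_) ?_
  · rw [hsucc]
    exact abs_bellman_sub_le hC hγ (hQq n) hqq (hdist n) p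
  · have := tendsto_pow_atTop_nhds_zero_of_lt_one hγ.le hγ1
    simpa using (((this.const_mul D).div_const (1 - γ)).const_mul γ)

end SupNorm

/-! ### The probability of falling short of a target -/

section Risk

variable {S A : Type*}

/-- The probability that the quantile function `u ↦ q(s,u,a)` of a uniform level is below `x`. -/
def risk (q : S × Level × A → ℝ) (s : S) (a : A) (x : ℝ) : ENNReal :=
  unif {u | q (s, u, a) < x}

theorem risk_le_one (q : S × Level × A → ℝ) (s : S) (a : A) (x : ℝ) : risk q s a x ≤ 1 :=
  prob_le_one

theorem risk_eq_one {q : S × Level × A → ℝ} {M : ℝ} (hM : ∀ p, |q p| ≤ M) {s : S} {a : A} {x : ℝ}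
    (hx : M < x) : risk q s a x = 1 := by
  have : {u : Level | q (s, u, a) < x} = Set.univ :=
    Set.eq_univ_of_forall fun u => (abs_le.1 (hM _)).2.trans_lt hx
  rw [risk, this, measure_univ]

theorem risk_eq_zero {q : S × Level × A → ℝ} {M : ℝ} (hM : ∀ p, |q p| ≤ M) {s : S} {a : A} {x : ℝ}
    (hx : x ≤ -M) : risk q s a x = 0 := by
  have : {u : Level | q (s, u, a) < x} = ∅ :=
    Set.eq_empty_of_forall_notMem fun u (hu : q (s, u, a) < x) => by
      linarith [(abs_le.1 (hM (s, u, a))).1]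
  rw [risk, this, measure_empty]

theorem risk_zero (s : S) (a : A) (x : ℝ) :
    risk (0 : S × Level × A → ℝ) s a x = if 0 < x then 1 else 0 := by
  split_ifs with h
  · exact risk_eq_one (M := 0) (by simp) h
  · exact risk_eq_zero (M := 0) (by simp) (by simpa using h)

/-- `q` is a quantile function in its level: it is determined by its shortfall probabilities. -/
def IsQuantile (q : S × Level × A → ℝ) : Prop :=
  ∀ (s : S) (α : Level) (a : A) (x : ℝ), x ≤ q (s, α, a) ↔ risk q s a x ≤ ENNReal.ofReal α

theorem IsQuantile.isLowerSet {q : S × Level × A → ℝ} (hq : IsQuantile q) (s : S) (a : A) (x : ℝ) :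
    IsLowerSet {u : Level | q (s, u, a) < x} := by
  intro u v hvu (hu : q (s, u, a) < x)
  show q (s, v, a) < x
  rw [← not_le, hq, not_le] at hu ⊢
  exact (ENNReal.ofReal_le_ofReal hvu).trans_lt hu

theorem IsQuantile.zero : IsQuantile (0 : S × Level × A → ℝ) := by
  intro s α a x
  rw [risk_zero]
  have := α.2.2
  split_ifs with h
  · simp [h.not_ge, this.not_ge]
  · simpa using h

variable [MeasurableSpace S] [MeasurableSpace A]

theorem measurable_risk {q : S × Level × A → ℝ} (hq : Measurable q) :
    Measurable fun y : S × A × ℝ => risk q y.1 y.2.1 y.2.2 := by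
  have hset : MeasurableSet {z : (S × A × ℝ) × Level | q (z.1.1, z.2, z.1.2.1) < z.1.2.2} :=
    measurableSet_lt (by fun_prop) (by fun_prop)
  exact measurable_measure_prodMk_left hset

variable [Fintype A] [Nonempty A] {P : Kernel (S × A) (ℝ × S)} [IsMarkovKernel P] {C γ : ℝ}

/-- Inverse transform sampling: a quantile function evaluated at a uniform level reproduces the law
it came from, here that of the backup. -/
theorem risk_bellman (hC : ∀ (s : S) (a : A), ∀ᵐ z ∂(P (s, a)), |z.1| ≤ C) (hγ : 0 < γ)
    {q : S × Level × A → ℝ} (hq : IsQFunction q) (s : S) (a : A) (x : ℝ) :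
    risk (bellman P γ q) s a x = (P (s, a)).prod unif {z | backup γ q z < x} := by
  have : {u : Level | bellman P γ q (s, u, a) < x}
      = {u : Level | (u : ℝ) < ((P (s, a)).prod unif {z | backup γ q z < x}).toReal} := by
    ext u
    simp only [Set.mem_ofPred_eq]
    rw [← not_le, le_bellman_iff hC hγ hq, not_le,
      ENNReal.ofReal_lt_iff_lt_toReal u.2.1 (measure_ne_top _ _)]
  rw [risk, this, unif_lt (ENNReal.toReal_le_of_le_ofReal zero_le_one (by simpa using prob_le_one)),
    ENNReal.ofReal_toReal (measure_ne_top _ _)]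

theorem IsQuantile.bellman (hC : ∀ (s : S) (a : A), ∀ᵐ z ∂(P (s, a)), |z.1| ≤ C) (hγ : 0 < γ)
    {q : S × Level × A → ℝ} (hq : IsQFunction q) : IsQuantile (bellman P γ q) := fun s α a x => by
  rw [risk_bellman hC hγ hq, le_bellman_iff hC hγ hq]

/-- The Bellman equation in terms of shortfall probabilities. -/
theorem risk_bellman_eq_lintegral (hC : ∀ (s : S) (a : A), ∀ᵐ z ∂(P (s, a)), |z.1| ≤ C)
    (hγ : 0 < γ) {q : S × Level × A → ℝ} (hq : IsQFunction q) (hq' : IsQuantile q) (s : S) (a : A)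
    (x : ℝ) : risk (bellman P γ q) s a x
      = ∫⁻ z, ⨅ a', risk q z.2 a' ((x - z.1) / γ) ∂P (s, a) := by
  rw [risk_bellman hC hγ hq,
    Measure.prod_apply (measurableSet_lt (measurable_backup γ hq.measurable) measurable_const)]
  refine lintegral_congr fun z => ?_
  have : Prod.mk z ⁻¹' {z : (ℝ × S) × Level | backup γ q z < x}
      = ⋂ a', {u : Level | q (z.2, u, a') < (x - z.1) / γ} := by
    ext u
    simp only [Set.mem_preimage, Set.mem_ofPred_eq, Set.mem_iInter, backup]
    rw [← maxAct_lt_iff, lt_div_iff₀ hγ, lt_sub_iff_add_lt', mul_comm γ]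
  rw [this]
  -- The maximum falls short exactly when every action does. These events are nested lower sets of
  -- levels, so their intersection is the smallest of them and its measure is the minimum of the
  -- measures.
  obtain ⟨i, hi⟩ := exists_iInter_eq_of_isLowerSet
    (fun a' => {u : Level | q (z.2, u, a') < (x - z.1) / γ}) (fun a' => hq'.isLowerSet _ _ _)
  refine le_antisymm (le_iInf fun a' => measure_mono (Set.iInter_subset _ a')) ?_
  rw [hi]
  exact iInf_le _ i

end Risk

/-! ### Trajectories -/

section Trajectory

variable {S A : Type*} [MeasurableSpace S] [MeasurableSpace A] {P : Kernel (S × A) (ℝ × S)}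
  [IsMarkovKernel P]

instance (π : Policy S A) (s : S) (a : A) : IsProbabilityMeasure (trajLaw P π s a) := by
  unfold trajLaw
  infer_instance

theorem measurable_reward (t : ℕ) : Measurable (reward t : (ℕ → Step S A) → ℝ) := by
  unfold reward
  fun_prop

theorem lintegral_trajLaw_zero (π : Policy S A) (s : S) (a : A)
    {f : ((i : Finset.Iic 0) → Step S A) → ENNReal} (hf : Measurable f) :
    ∫⁻ ω, f (Preorder.frestrictLe 0 ω) ∂trajLaw P π s a = f fun _ => ((0, s), a) := by
  rw [← lintegral_map hf (Preorder.measurable_frestrictLe 0), trajLaw,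
    Kernel.traj_map_frestrictLe_apply, Kernel.partialTraj_self, Kernel.id_apply,
    lintegral_dirac' _ hf]

/-- Disintegration of one step of the Ionescu-Tulcea law: condition on the history, then draw reward
and state, then the action. -/
theorem lintegral_trajLaw_succ (π : Policy S A) (s : S) (a : A) (n : ℕ)
    {f : ((i : Finset.Iic n) → Step S A) → Step S A → ENNReal}
    (hf : Measurable (Function.uncurry f)) :
    ∫⁻ ω, f (Preorder.frestrictLe n ω) (ω (n + 1)) ∂trajLaw P π s a
      = ∫⁻ ω, ∫⁻ z, ∫⁻ a', f (Preorder.frestrictLe n ω) (z, a')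
          ∂π.rule n (Preorder.frestrictLe n ω, z) ∂P (lastPair n (Preorder.frestrictLe n ω))
          ∂trajLaw P π s a := by
  have := π.isMarkov n
  have h1 : ∫⁻ ω, f (Preorder.frestrictLe n ω) (ω (n + 1)) ∂trajLaw P π s a
      = ∫⁻ y, Function.uncurry f y ∂((trajLaw P π s a).map
        fun ω => (Preorder.frestrictLe n ω, ω (n + 1))) := by
    rw [lintegral_map hf (by fun_prop)]
    rfl
  rw [h1, trajLaw, ← Kernel.partialTraj_compProd_eq_map_traj (Nat.zero_le n),
    Measure.lintegral_compProd hf, ← Kernel.traj_map_frestrictLe_apply,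
    lintegral_map (hf.lintegral_kernel_prod_right') (by fun_prop)]
  refine lintegral_congr fun ω => ?_
  rw [stepKernel, Kernel.lintegral_compProd _ _ _ (by fun_prop), Kernel.comap_apply]
  rfl

variable {C γ : ℝ}

theorem ae_abs_reward_le (hC : ∀ (s : S) (a : A), ∀ᵐ z ∂(P (s, a)), |z.1| ≤ C) (π : Policy S A)
    (s : S) (a : A) : ∀ᵐ ω ∂trajLaw P π s a, ∀ t, |reward t ω| ≤ C := by
  refine ae_all_iff.2 fun n => ?_
  let B : Set ℝ := {r | C < |r|}
  have hB : MeasurableSet B := measurableSet_lt measurable_const (by fun_prop)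
  have hf : Measurable (Function.uncurry fun (_ : (i : Finset.Iic n) → Step S A) (y : Step S A) =>
      B.indicator (fun _ => (1 : ENNReal)) y.1.1) :=
    (measurable_const.indicator hB).comp
      (by fun_prop : Measurable fun y : ((i : Finset.Iic n) → Step S A) × Step S A => y.2.1.1)
  have h := lintegral_trajLaw_succ (P := P) π s a n hf
  have h0 : ∀ ω : ℕ → Step S A, ∫⁻ z, ∫⁻ _, B.indicator (fun _ => (1 : ENNReal)) z.1
      ∂π.rule n (Preorder.frestrictLe n ω, z) ∂P (lastPair n (Preorder.frestrictLe n ω)) = 0 := by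
    intro ω
    -- The integrand vanishes almost everywhere; this gives both its a.e. measurability and the
    -- value of the integral.
    rw [lintegral_eq_zero_iff' (AEMeasurable.congr (f := fun _ => 0) (by fun_prop) ?_)] <;>
    · filter_upwards [hC (lastPair n (Preorder.frestrictLe n ω)).1
        (lastPair n (Preorder.frestrictLe n ω)).2] with z hz
      have : z.1 ∉ B := not_lt.2 hz
      simp [Set.indicator_of_notMem this]
  rw [lintegral_congr h0, lintegral_zero, lintegral_eq_zero_iff
    (f := fun ω : ℕ → Step S A => B.indicator (fun _ => (1 : ENNReal)) (ω (n + 1)).1.1)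
    ((measurable_const.indicator hB).comp (measurable_reward n))] at h
  filter_upwards [h] with ω hω
  by_contra! hlt
  have : reward n ω ∈ B := hlt
  rw [reward] at this
  simp [Set.indicator_of_mem this] at hω

/-- The target left over after a history: a return below `x` at time `0` amounts to a return below
`target γ x n h` from time `n` on. -/
def target (γ x : ℝ) (n : ℕ) (h : (i : Finset.Iic n) → Step S A) : ℝ :=
  (x - ∑ i : Fin n, γ ^ (i : ℕ) * (h ⟨i + 1, Finset.mem_Iic.2 i.2⟩).1.1) / γ ^ n

theorem measurable_target (γ x : ℝ) (n : ℕ) :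
    Measurable (target γ x n : ((i : Finset.Iic n) → Step S A) → ℝ) := by
  unfold target
  fun_prop

omit [MeasurableSpace S] [MeasurableSpace A] in
theorem target_frestrictLe (γ x : ℝ) (n : ℕ) (ω : ℕ → Step S A) :
    target γ x n (Preorder.frestrictLe n ω)
      = (x - ∑ t ∈ Finset.range n, γ ^ t * reward t ω) / γ ^ n := by
  rw [← Fin.sum_univ_eq_sum_range (fun t => γ ^ t * reward t ω)]
  rfl

omit [MeasurableSpace S] [MeasurableSpace A] in
-- The update of the target matches the argument `(x - r)/γ` in the Bellman equation for risks, so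
-- that equation can be iterated along a trajectory.
theorem target_succ (hγ : 0 < γ) (x : ℝ) (n : ℕ) (ω : ℕ → Step S A) :
    target γ x (n + 1) (Preorder.frestrictLe (n + 1) ω)
      = (target γ x n (Preorder.frestrictLe n ω) - (ω (n + 1)).1.1) / γ := by
  rw [target_frestrictLe, target_frestrictLe, Finset.sum_range_succ, pow_succ]
  change _ = (_ - reward n ω) / γ
  field_simp
  ring

/-- The shortfall probability `risk q` with respect to the left-over target, as a function of the
history. -/
def histRisk (γ : ℝ) (q : S × Level × A → ℝ) (x : ℝ) (n : ℕ) (h : (i : Finset.Iic n) → Step S A) :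
    ENNReal :=
  risk q (lastPair n h).1 (lastPair n h).2 (target γ x n h)

theorem measurable_histRisk (γ : ℝ) {q : S × Level × A → ℝ} (hq : Measurable q) (x : ℝ) (n : ℕ) :
    Measurable (histRisk γ q x n : ((i : Finset.Iic n) → Step S A) → ENNReal) := by
  have h1 := measurable_lastPair (S := S) (A := A) n
  have h2 := measurable_target (S := S) (A := A) γ x n
  exact (measurable_risk hq).comp (h1.fst.prodMk (h1.snd.prodMk h2))

/-- The expectation of `histRisk`. -/
def meanRisk (P : Kernel (S × A) (ℝ × S)) [IsMarkovKernel P] (γ : ℝ) (π : Policy S A) (s : S)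
    (a : A) (q : S × Level × A → ℝ) (x : ℝ) (n : ℕ) : ENNReal :=
  ∫⁻ ω, histRisk γ q x n (Preorder.frestrictLe n ω) ∂trajLaw P π s a

theorem meanRisk_zero (π : Policy S A) (s : S) (a : A) {q : S × Level × A → ℝ}
    (hq : Measurable q) (x : ℝ) : meanRisk P γ π s a q x 0 = risk q s a x := by
  rw [meanRisk, lintegral_trajLaw_zero π s a (measurable_histRisk γ hq x 0)]
  simp [histRisk, target, lastPair]

theorem meanRisk_succ (hγ : 0 < γ) (π : Policy S A) (s : S) (a : A) {q : S × Level × A → ℝ}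
    (hq : Measurable q) (x : ℝ) (n : ℕ) : meanRisk P γ π s a q x (n + 1)
      = ∫⁻ ω, ∫⁻ z, ∫⁻ a', risk q z.2 a' ((target γ x n (Preorder.frestrictLe n ω) - z.1) / γ)
          ∂π.rule n (Preorder.frestrictLe n ω, z) ∂P (lastPair n (Preorder.frestrictLe n ω))
          ∂trajLaw P π s a := by
  have h2 := measurable_target (S := S) (A := A) γ x n
  have hf : Measurable (Function.uncurry fun (h : (i : Finset.Iic n) → Step S A) (y : Step S A) =>
      risk q y.1.2 y.2 ((target γ x n h - y.1.1) / γ)) :=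
    (measurable_risk hq).comp (by fun_prop :
      Measurable fun y : ((i : Finset.Iic n) → Step S A) × Step S A =>
        (y.2.1.2, y.2.2, (target γ x n y.1 - y.2.1.1) / γ))
  rw [← lintegral_trajLaw_succ π s a n hf]
  refine lintegral_congr fun ω => ?_
  rw [histRisk, target_succ hγ]
  rfl

/-! ### Mean risk under arbitrary and greedy policies -/

variable [Fintype A] [Nonempty A]

/-- However the next action is randomized, the average of its risk is at least the minimum over
actions. -/
theorem meanRisk_bellman_le (hC : ∀ (s : S) (a : A), ∀ᵐ z ∂(P (s, a)), |z.1| ≤ C) (hγ : 0 < γ)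
    (π : Policy S A) (s : S) (a : A) {q : S × Level × A → ℝ} (hq : IsQFunction q)
    (hq' : IsQuantile q) (x : ℝ) (n : ℕ) :
    meanRisk P γ π s a (bellman P γ q) x n ≤ meanRisk P γ π s a q x (n + 1) := by
  rw [meanRisk_succ hγ π s a hq.measurable, meanRisk]
  refine lintegral_mono fun ω => ?_
  rw [histRisk, risk_bellman_eq_lintegral hC hγ hq hq']
  refine lintegral_mono fun z => ?_
  have := π.isMarkov n
  set g := fun a' => risk q z.2 a' ((target γ x n (Preorder.frestrictLe n ω) - z.1) / γ)
  calc ⨅ a', g a' = ∫⁻ _, ⨅ a', g a' ∂π.rule n (Preorder.frestrictLe n ω, z) := by simp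
    _ ≤ _ := lintegral_mono fun a' => iInf_le g a'

/-- A policy that plays, at each time, an action minimizing the shortfall probability for the
left-over target. -/
theorem exists_greedy_policy [MeasurableSingletonClass A] {qs : ℕ → S × Level × A → ℝ}
    (hqs : ∀ n, Measurable (qs n)) (γ x : ℝ) :
    ∃ π : Policy S A, π.IsDeterministic ∧ ∀ n h z,
      ∫⁻ a', risk (qs (n + 1)) z.2 a' ((target γ x n h - z.1) / γ) ∂π.rule n (h, z)
        = ⨅ a', risk (qs (n + 1)) z.2 a' ((target γ x n h - z.1) / γ) := by
  have hex : ∀ n, ∃ f : ((i : Finset.Iic n) → Step S A) × (ℝ × S) → A, Measurable f ∧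
      ∀ y, risk (qs (n + 1)) y.2.2 (f y) ((target γ x n y.1 - y.2.1) / γ)
        = ⨅ a', risk (qs (n + 1)) y.2.2 a' ((target γ x n y.1 - y.2.1) / γ) := fun n => by
    have h2 := measurable_target (S := S) (A := A) γ x n
    exact exists_measurable_argmin _ fun a' => (measurable_risk (hqs (n + 1))).comp (by fun_prop :
      Measurable fun y : ((i : Finset.Iic n) → Step S A) × (ℝ × S) =>
        (y.2.2, a', (target γ x n y.1 - y.2.1) / γ))
  choose f hf hmin using hex
  refine ⟨⟨fun n => Kernel.deterministic (f n) (hf n), fun n => inferInstance⟩,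
    fun n => ⟨f n, hf n, rfl⟩, fun n h z => ?_⟩
  rw [Kernel.lintegral_deterministic' _ (by fun_prop)]
  exact hmin n (h, z)

/-- Here `qs n` is the value after `n` elapsed steps: `𝓑^(T - n) 0` for horizon `T`, the constant
fixed point for infinite horizon. -/
theorem risk_le_meanRisk (hC : ∀ (s : S) (a : A), ∀ᵐ z ∂(P (s, a)), |z.1| ≤ C) (hγ : 0 < γ)
    {qs : ℕ → S × Level × A → ℝ} (hq : ∀ n, IsQFunction (qs n)) (hq' : ∀ n, IsQuantile (qs n))
    (π : Policy S A) (s : S) (a : A) (x : ℝ) {m : ℕ}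
    (hqs : ∀ n < m, qs n = bellman P γ (qs (n + 1))) :
    risk (qs 0) s a x ≤ meanRisk P γ π s a (qs m) x m := by
  induction m with
  | zero => rw [meanRisk_zero π s a (hq 0).measurable]
  | succ m ih =>
    refine (ih fun n hn => hqs n (hn.trans m.lt_succ_self)).trans ?_
    rw [hqs m m.lt_succ_self]
    exact meanRisk_bellman_le hC hγ π s a (hq _) (hq' _) x m

/-- The greedy policy turns each inequality of `risk_le_meanRisk` into an equality. One policy
serves all `m`, as the limit `m → ∞` requires. -/
theorem exists_meanRisk_eq_risk [MeasurableSingletonClass A]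
    (hC : ∀ (s : S) (a : A), ∀ᵐ z ∂(P (s, a)), |z.1| ≤ C) (hγ : 0 < γ)
    {qs : ℕ → S × Level × A → ℝ} (hq : ∀ n, IsQFunction (qs n)) (hq' : ∀ n, IsQuantile (qs n))
    (s : S) (a : A) (x : ℝ) :
    ∃ π : Policy S A, π.IsDeterministic ∧ ∀ m, (∀ n < m, qs n = bellman P γ (qs (n + 1))) →
      meanRisk P γ π s a (qs m) x m = risk (qs 0) s a x := by
  obtain ⟨π, hdet, hπ⟩ := exists_greedy_policy (fun n => (hq n).measurable) γ x
  refine ⟨π, hdet, fun m hm => ?_⟩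
  induction m with
  | zero => rw [meanRisk_zero π s a (hq 0).measurable]
  | succ m ih =>
    rw [← ih fun n hn => hm n (hn.trans m.lt_succ_self),
      meanRisk_succ hγ π s a (hq _).measurable, meanRisk]
    refine lintegral_congr fun ω => ?_
    rw [hm m m.lt_succ_self, histRisk, risk_bellman_eq_lintegral hC hγ (hq _) (hq' _)]
    exact lintegral_congr fun z => hπ m _ z

end Trajectory

/-! ### Finite and infinite horizon -/

section Horizon

open Filter

variable {S A : Type*} [MeasurableSpace S] [MeasurableSpace A] {P : Kernel (S × A) (ℝ × S)}
  [IsMarkovKernel P] {C γ : ℝ}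

theorem meanRisk_zero_right (hγ : 0 < γ) (π : Policy S A) (s : S) (a : A) (x : ℝ) (T : ℕ) :
    meanRisk P γ π s a 0 x T
      = trajLaw P π s a {ω | ∑ t ∈ Finset.range T, γ ^ t * reward t ω < x} := by
  have hm : Measurable fun ω : ℕ → Step S A => ∑ t ∈ Finset.range T, γ ^ t * reward t ω :=
    Finset.measurable_sum _ fun t _ => (measurable_reward t).const_mul _
  rw [← lintegral_indicator_one (measurableSet_lt hm measurable_const), meanRisk]
  refine lintegral_congr fun ω => ?_
  rw [histRisk, risk_zero, target_frestrictLe]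
  have : 0 < (x - ∑ t ∈ Finset.range T, γ ^ t * reward t ω) / γ ^ T ↔
      ∑ t ∈ Finset.range T, γ ^ t * reward t ω < x := by
    rw [div_pos_iff_of_pos_right (pow_pos hγ T), sub_pos]
  simp [this, Set.indicator_apply]

theorem ae_abs_sum_reward_le (hC : ∀ (s : S) (a : A), ∀ᵐ z ∂(P (s, a)), |z.1| ≤ C) (hγ : 0 < γ)
    (π : Policy S A) (s : S) (a : A) (T : ℕ) :
    ∀ᵐ ω ∂trajLaw P π s a, |∑ t ∈ Finset.range T, γ ^ t * reward t ω|
      ≤ ∑ t ∈ Finset.range T, γ ^ t * C := by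
  filter_upwards [ae_abs_reward_le hC π s a] with ω hω
  refine (Finset.abs_sum_le_sum_abs _ _).trans (Finset.sum_le_sum fun t _ => ?_)
  rw [abs_mul, abs_of_pos (pow_pos hγ t)]
  exact mul_le_mul_of_nonneg_left (hω t) (pow_pos hγ t).le

/-- On a trajectory that is not summable `∑'` takes the default value `0`; such trajectories form a
null set. -/
theorem ae_hasSum_reward (hC : ∀ (s : S) (a : A), ∀ᵐ z ∂(P (s, a)), |z.1| ≤ C) (hγ : 0 < γ)
    (hγ1 : γ < 1) (π : Policy S A) (s : S) (a : A) :
    ∀ᵐ ω ∂trajLaw P π s a, HasSum (fun t => γ ^ t * reward t ω) (∑' t, γ ^ t * reward t ω) ∧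
      |∑' t, γ ^ t * reward t ω| ≤ (1 - γ)⁻¹ * C := by
  filter_upwards [ae_abs_reward_le hC π s a] with ω hω
  have hb : ∀ t, ‖γ ^ t * reward t ω‖ ≤ γ ^ t * C := fun t => by
    rw [norm_mul, Real.norm_of_nonneg (pow_pos hγ t).le]
    exact mul_le_mul_of_nonneg_left (hω t) (pow_pos hγ t).le
  have hs := (hasSum_geometric_of_lt_one hγ.le hγ1).mul_right C
  exact ⟨(Summable.of_norm_bounded hs.summable hb).hasSum, tsum_of_norm_bounded hs hb⟩

omit [MeasurableSpace S] [MeasurableSpace A] in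
theorem tendsto_target_atTop (hγ : 0 < γ) (hγ1 : γ < 1) {x R : ℝ} {ω : ℕ → Step S A}
    (h : HasSum (fun t => γ ^ t * reward t ω) R) (hx : R < x) :
    Tendsto (fun n => target γ x n (Preorder.frestrictLe n ω)) atTop atTop := by
  simp_rw [target_frestrictLe, div_eq_mul_inv, ← inv_pow]
  exact (h.tendsto_sum_nat.const_sub x).pos_mul_atTop (sub_pos.2 hx)
    (tendsto_pow_atTop_atTop_of_one_lt ((one_lt_inv₀ hγ).2 hγ1))

omit [MeasurableSpace S] [MeasurableSpace A] in
theorem tendsto_target_atBot (hγ : 0 < γ) (hγ1 : γ < 1) {x R : ℝ} {ω : ℕ → Step S A}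
    (h : HasSum (fun t => γ ^ t * reward t ω) R) (hx : x < R) :
    Tendsto (fun n => target γ x n (Preorder.frestrictLe n ω)) atTop atBot := by
  simp_rw [target_frestrictLe, div_eq_mul_inv, ← inv_pow]
  exact (h.tendsto_sum_nat.const_sub x).neg_mul_atTop (sub_neg.2 hx)
    (tendsto_pow_atTop_atTop_of_one_lt ((one_lt_inv₀ hγ).2 hγ1))

/-- On `R < x` the target tends to `+∞`, so the risk is eventually `1`; Markov's inequality and
Fatou's lemma conclude. -/
theorem measure_tsum_lt_le (hC : ∀ (s : S) (a : A), ∀ᵐ z ∂(P (s, a)), |z.1| ≤ C) (hγ : 0 < γ)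
    (hγ1 : γ < 1) (π : Policy S A) (s : S) (a : A) {q : S × Level × A → ℝ} (hq : IsQFunction q)
    {x : ℝ} {c : ENNReal} (h : ∀ n, meanRisk P γ π s a q x n ≤ c) :
    trajLaw P π s a {ω | ∑' t, γ ^ t * reward t ω < x} ≤ c := by
  obtain ⟨M, hM⟩ := hq.bounded
  have hmeas : ∀ n, Measurable fun ω : ℕ → Step S A => histRisk γ q x n (Preorder.frestrictLe n ω) :=
    fun n => (measurable_histRisk γ hq.measurable x n).comp (Preorder.measurable_frestrictLe n)
  set f : (ℕ → Step S A) → ENNReal := fun ω =>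
    liminf (fun n => histRisk γ q x n (Preorder.frestrictLe n ω)) atTop with hf
  calc trajLaw P π s a {ω | ∑' t, γ ^ t * reward t ω < x}
      ≤ trajLaw P π s a {ω | 1 ≤ f ω} := by
        refine measure_mono_ae ?_
        filter_upwards [ae_hasSum_reward hC hγ hγ1 π s a] with ω hω hlt
        have hev : ∀ᶠ n in atTop, (1 : ENNReal) ≤ histRisk γ q x n (Preorder.frestrictLe n ω) := by
          filter_upwards [(tendsto_target_atTop hγ hγ1 hω.1 hlt).eventually_gt_atTop M] with n hn
          exact (risk_eq_one hM hn).ge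
        exact le_liminf_of_le (by isBoundedDefault) hev
    _ ≤ ∫⁻ ω, f ω ∂trajLaw P π s a := by
        simpa using mul_meas_ge_le_lintegral (μ := trajLaw P π s a) (Measurable.liminf hmeas) 1
    _ ≤ liminf (fun n => meanRisk P γ π s a q x n) atTop := lintegral_liminf_le hmeas
    _ ≤ liminf (fun _ : ℕ => c) atTop := liminf_le_liminf (Eventually.of_forall h)
    _ = c := liminf_const c

/-- Reverse Fatou, with dominating function `1`: on `R ≥ y` the target tends to `-∞` and the risk is
eventually `0`. The gap `x < y` avoids trajectories with `R = x`, where the target need not diverge.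
-/
theorem le_measure_tsum_lt (hC : ∀ (s : S) (a : A), ∀ᵐ z ∂(P (s, a)), |z.1| ≤ C) (hγ : 0 < γ)
    (hγ1 : γ < 1) (π : Policy S A) (s : S) (a : A) {q : S × Level × A → ℝ} (hq : IsQFunction q)
    {x y : ℝ} (hxy : x < y) {c : ENNReal} (h : ∀ n, c ≤ meanRisk P γ π s a q x n) :
    c ≤ trajLaw P π s a {ω | ∑' t, γ ^ t * reward t ω < y} := by
  obtain ⟨M, hM⟩ := hq.bounded
  have hmeas : ∀ n, Measurable fun ω : ℕ → Step S A => histRisk γ q x n (Preorder.frestrictLe n ω) :=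
    fun n => (measurable_histRisk γ hq.measurable x n).comp (Preorder.measurable_frestrictLe n)
  calc c = limsup (fun _ : ℕ => c) atTop := (limsup_const c).symm
    _ ≤ limsup (fun n => meanRisk P γ π s a q x n) atTop :=
        limsup_le_limsup (Eventually.of_forall h)
    _ ≤ ∫⁻ ω, limsup (fun n => histRisk γ q x n (Preorder.frestrictLe n ω)) atTop
          ∂trajLaw P π s a :=
        limsup_lintegral_le (fun _ => 1) hmeas
          (fun n => Eventually.of_forall fun ω => risk_le_one _ _ _ _) (by simp)
    _ ≤ ∫⁻ ω, Set.indicator {ω | ∑' t, γ ^ t * reward t ω < y} 1 ω ∂trajLaw P π s a := by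
        refine lintegral_mono_ae ?_
        filter_upwards [ae_hasSum_reward hC hγ hγ1 π s a] with ω hω
        by_cases hlt : ∑' t, γ ^ t * reward t ω < y
        · rw [Set.indicator_of_mem (by exact hlt)]
          exact limsup_le_of_le (by isBoundedDefault)
            (Eventually.of_forall fun n => risk_le_one _ _ _ _)
        · refine (limsup_le_of_le (by isBoundedDefault) ?_).trans zero_le
          filter_upwards [(tendsto_target_atBot hγ hγ1 hω.1
            (hxy.trans_le (not_lt.1 hlt))).eventually_le_atBot (-M)] with n hn
          exact (risk_eq_zero hM hn).le
    _ ≤ _ := lintegral_indicator_one_le _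

/-! ### Optimal values as iterates and fixed points of the Bellman operator -/

variable [Fintype A] [Nonempty A]

theorem isQuantile_iterate (hC : ∀ (s : S) (a : A), ∀ᵐ z ∂(P (s, a)), |z.1| ≤ C) (hγ : 0 < γ)
    (T : ℕ) : IsQuantile ((bellman P γ)^[T] 0) := by
  cases T with
  | zero => exact IsQuantile.zero
  | succ T =>
    rw [Function.iterate_succ_apply']
    exact IsQuantile.bellman hC hγ (IsQFunction.zero.iterate hC hγ T)

omit [IsMarkovKernel P] in
theorem iterate_bellman_tsub (T : ℕ) : ∀ n < T, (bellman P γ)^[T - n] 0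
    = bellman P γ ((bellman P γ)^[T - (n + 1)] 0) := fun n hn => by
  rw [← Function.iterate_succ_apply' (bellman P γ), Nat.succ_eq_add_one,
    show T - (n + 1) + 1 = T - n by omega]

theorem policyValueFin_le (hC : ∀ (s : S) (a : A), ∀ᵐ z ∂(P (s, a)), |z.1| ≤ C) (hγ : 0 < γ)
    (T : ℕ) (p : S × Level × A) (π : Policy S A) :
    policyValueFin P γ T p π ≤ (bellman P γ)^[T] 0 p := by
  obtain ⟨s, α, a⟩ := p
  rw [isQuantile_iterate hC hγ T s α a]
  have h := risk_le_meanRisk (P := P) hC hγ (qs := fun n => (bellman P γ)^[T - n] 0)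
    (fun n => IsQFunction.zero.iterate hC hγ _) (fun n => isQuantile_iterate hC hγ _) π s a
    (policyValueFin P γ T (s, α, a) π) (m := T) (iterate_bellman_tsub T)
  simp only [Nat.sub_self, Function.iterate_zero, id_eq, Nat.sub_zero] at h
  refine h.trans ?_
  rw [meanRisk_zero_right hγ]
  exact (le_VaR_iff (ae_abs_sum_reward_le hC hγ π s a T) α.2.1 α.2.2).1 le_rfl

theorem exists_policyValueFin_eq [MeasurableSingletonClass A]
    (hC : ∀ (s : S) (a : A), ∀ᵐ z ∂(P (s, a)), |z.1| ≤ C) (hγ : 0 < γ)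
    (T : ℕ) (p : S × Level × A) :
    ∃ π : Policy S A, π.IsDeterministic ∧
      policyValueFin P γ T p π = (bellman P γ)^[T] 0 p := by
  obtain ⟨s, α, a⟩ := p
  -- The policy is greedy for the target equal to the claimed optimal value, so it depends on `α`
  -- through that number.
  obtain ⟨π, hdet, hπ⟩ := exists_meanRisk_eq_risk (P := P) hC hγ
    (qs := fun n => (bellman P γ)^[T - n] 0) (fun n => IsQFunction.zero.iterate hC hγ _)
    (fun n => isQuantile_iterate hC hγ _) s a ((bellman P γ)^[T] 0 (s, α, a))
  refine ⟨π, hdet, (policyValueFin_le hC hγ T _ π).antisymm ?_⟩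
  have h := hπ T (iterate_bellman_tsub T)
  simp only [Nat.sub_self, Function.iterate_zero, id_eq, Nat.sub_zero, meanRisk_zero_right hγ] at h
  refine (le_VaR_iff (ae_abs_sum_reward_le hC hγ π s a T) α.2.1 α.2.2).2 ?_
  rw [h]
  exact (isQuantile_iterate hC hγ T s α a _).1 le_rfl

theorem policyValue_le (hC : ∀ (s : S) (a : A), ∀ᵐ z ∂(P (s, a)), |z.1| ≤ C) (hγ : 0 < γ)
    (hγ1 : γ < 1) {q : S × Level × A → ℝ} (hq : IsQFunction q) (hfix : bellman P γ q = q)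
    (p : S × Level × A) (π : Policy S A) : policyValue P γ p π ≤ q p := by
  obtain ⟨s, α, a⟩ := p
  have hq' : IsQuantile q := hfix ▸ IsQuantile.bellman hC hγ hq
  -- A target strictly below the value of `π` leaves the gap that reverse Fatou needs.
  refine le_of_forall_lt_imp_le_of_dense fun x hx => ?_
  rw [hq' s α a]
  refine (le_measure_tsum_lt hC hγ hγ1 π s a hq hx fun n => ?_).trans
    ((le_VaR_iff ((ae_hasSum_reward hC hγ hγ1 π s a).mono fun _ h => h.2) α.2.1 α.2.2).1 le_rfl)
  exact risk_le_meanRisk hC hγ (qs := fun _ => q) (fun _ => hq) (fun _ => hq') π s a x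
    fun _ _ => hfix.symm

theorem exists_policyValue_eq [MeasurableSingletonClass A]
    (hC : ∀ (s : S) (a : A), ∀ᵐ z ∂(P (s, a)), |z.1| ≤ C) (hγ : 0 < γ)
    (hγ1 : γ < 1) {q : S × Level × A → ℝ} (hq : IsQFunction q) (hfix : bellman P γ q = q)
    (p : S × Level × A) : ∃ π : Policy S A, π.IsDeterministic ∧ policyValue P γ p π = q p := by
  obtain ⟨s, α, a⟩ := p
  have hq' : IsQuantile q := hfix ▸ IsQuantile.bellman hC hγ hq
  obtain ⟨π, hdet, hπ⟩ := exists_meanRisk_eq_risk (P := P) hC hγ (qs := fun _ => q)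
    (fun _ => hq) (fun _ => hq') s a (q (s, α, a))
  refine ⟨π, hdet, (policyValue_le hC hγ hγ1 hq hfix _ π).antisymm ?_⟩
  refine (le_VaR_iff ((ae_hasSum_reward hC hγ hγ1 π s a).mono fun _ h => h.2) α.2.1 α.2.2).2 ?_
  -- Fatou handles the strict event `R < x` at the exact target, so the optimum is attained without
  -- any gap.
  exact measure_tsum_lt_le hC hγ hγ1 π s a hq fun n =>
    (hπ n fun _ _ => hfix.symm).trans_le ((hq' s α a _).1 le_rfl)

end Horizon

end QuantileMDP

end

/-! ### The main theorem -/

open QuantileMDP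
theorem mainTheorem5 {S A : Type*} [MeasurableSpace S] [MeasurableSpace A]
    [MeasurableSingletonClass A] [Fintype A] [Nonempty A]
    (P : Kernel (S × A) (ℝ × S)) [IsMarkovKernel P]
    (C : ℝ) (hC : ∀ (s : S) (a : A), ∀ᵐ z ∂(P (s, a)), |z.1| ≤ C)
    (γ : ℝ) (hγ0 : 0 < γ) (hγ1 : γ < 1) :
    -- the Bellman operator is a `γ`-contraction in sup norm
    (∀ q : S × Level × A → ℝ, IsQFunction q → IsQFunction (bellman P γ q)) ∧
    (∀ q₁ q₂ : S × Level × A → ℝ, IsQFunction q₁ → IsQFunction q₂ →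
      supNorm (bellman P γ q₁ - bellman P γ q₂) ≤ γ * supNorm (q₁ - q₂)) ∧
    -- the suprema defining the optimal values are maxima, attained by deterministic policies
    (∀ (T : ℕ) (p : S × Level × A),
      IsGreatest (Set.range (policyValueFin P γ T p)) (qFin P γ T p) ∧
      ∃ π : Policy S A, π.IsDeterministic ∧ policyValueFin P γ T p π = qFin P γ T p) ∧
    (∀ p : S × Level × A,
      IsGreatest (Set.range (policyValue P γ p)) (qStar P γ p) ∧
      ∃ π : Policy S A, π.IsDeterministic ∧ policyValue P γ p π = qStar P γ p) ∧
    -- `q*` is the unique fixed point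
    (IsQFunction (qStar P γ) ∧ bellman P γ (qStar P γ) = qStar P γ ∧
      ∀ q : S × Level × A → ℝ, IsQFunction q → bellman P γ q = q → q = qStar P γ) ∧
    -- `q*` is the uniform limit of the finite-horizon values `q*_T = 𝓑^T 0`
    (∀ T : ℕ, qFin P γ T = (bellman P γ)^[T] 0) ∧
    (∀ T : ℕ, supNorm (qFin P γ T - qStar P γ) ≤ γ ^ T * supNorm (qStar P γ)) ∧
    TendstoUniformly (fun T : ℕ => qFin P γ T) (qStar P γ) Filter.atTop := by
  obtain ⟨q, hq, hfix⟩ := exists_bellman_fixedPoint hC hγ0 hγ1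
  have hgFin : ∀ T p, IsGreatest (Set.range (policyValueFin P γ T p)) ((bellman P γ)^[T] 0 p) :=
    fun T p => by
      obtain ⟨π, -, hπ⟩ := exists_policyValueFin_eq hC hγ0 T p
      exact ⟨⟨π, hπ⟩, by rintro _ ⟨π, rfl⟩; exact policyValueFin_le hC hγ0 T p π⟩
  have hg : ∀ p, IsGreatest (Set.range (policyValue P γ p)) (q p) := fun p => by
    obtain ⟨π, -, hπ⟩ := exists_policyValue_eq hC hγ0 hγ1 hq hfix p
    exact ⟨⟨π, hπ⟩, by rintro _ ⟨π, rfl⟩; exact policyValue_le hC hγ0 hγ1 hq hfix p π⟩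
  have hFin : ∀ T, qFin P γ T = (bellman P γ)^[T] 0 := fun T => funext fun p => (hgFin T p).csSup_eq
  have hStar : qStar P γ = q := funext fun p => (hg p).csSup_eq
  have hbound : ∀ T : ℕ, supNorm (qFin P γ T - qStar P γ) ≤ γ ^ T * supNorm (qStar P γ) := by
    intro T
    have h := supNorm_iterate_sub_le hC hγ0 IsQFunction.zero hq T
    -- As `q` is fixed by `𝓑^T`, the distance from `𝓑^T 0` to `q` is at most `γ ^ T` times that from
    -- `0` to `q`.
    rw [Function.iterate_fixed hfix] at h
    have hneg : supNorm (0 - q) = supNorm q := by simp [supNorm]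
    rwa [hFin, hStar, ← hneg]
  refine ⟨fun q hq => hq.bellman hC hγ0, fun q₁ q₂ h₁ h₂ => supNorm_bellman_sub_le hC hγ0 h₁ h₂,
    fun T p => ?_, fun p => ?_, ?_, hFin, hbound, ?_⟩
  · rw [hFin]
    exact ⟨hgFin T p, exists_policyValueFin_eq hC hγ0 T p⟩
  · rw [hStar]
    exact ⟨hg p, exists_policyValue_eq hC hγ0 hγ1 hq hfix p⟩
  · rw [hStar]
    exact ⟨hq, hfix, fun q' hq' hfix' => bellman_unique hC hγ0 hγ1 hq' hq hfix' hfix⟩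
  · rw [Metric.tendstoUniformly_iff]
    intro ε hε
    have hlim : Filter.Tendsto (fun T : ℕ => γ ^ T * supNorm (qStar P γ)) Filter.atTop (nhds 0) := by
      simpa using (tendsto_pow_atTop_nhds_zero_of_lt_one hγ0.le hγ1).mul_const
        (supNorm (qStar P γ))
    filter_upwards [hlim.eventually_lt_const hε] with T hT p
    rw [dist_comm]
    have hsub : IsQFunction (qFin P γ T - qStar P γ) := by
      rw [hFin, hStar]
      exact (IsQFunction.zero.iterate hC hγ0 T).sub hq
    exact ((hsub.abs_le_supNorm p).trans (hbound T)).trans_lt hT
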